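/- Let $\mathbb T=\mathbb R/\mathbb Z$ and let $M$ be one of the following three surfaces: the closed cylinder $\mathbb A=\mathbb T\times[-1,1]$, the closed unit disk $\mathbb D\subset\mathbb R^2$, or the unit sphere $\mathbb S\subset\mathbb R^3$, each with its canonical symplectic (area) form and the associated normalized area (probability) measure $\mathrm{Leb}_M$. For $\alpha\in\mathbb T$ let $R_\alpha$ be the rotation of $M$ by $\alpha$ (translation by $\alpha$ in the $\mathbb T$-coordinate on $\mathbb A$, rotation by the angle $2\pi\alpha$ about the origin on $\mathbb D$ and about the $x_3$-axis on $\mathbb S$). Let $\pi:\mathbb A\to M$ be the continuous surjection given by $\pi(\theta,y)=(\theta,y)$ if $M=\mathbb A$, $\pi(\theta,y)=\sqrt{\tfrac{1+y}{2}}\,(\cos 2\pi\theta,\sin 2\pi\theta)$ if $M=\mathbb D$, and $\pi(\theta,y)=(\sqrt{1-y^2}\cos 2\pi\theta,\sqrt{1-y^2}\sin 2\pi\theta,y)$ if $M=\mathbb S$, and put $\mu_{\pm1}=\pi_*\mathrm{Leb}_{\mathbb T\times\{\pm1\}}$. Let $\mathrm{Symp}^0(M)$ be the set of symplectic homeomorphisms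 of $M$, that is, the $C^0$-closure, among the homeomorphisms of $M$, of the set of $C^1$-diffeomorphisms preserving the symplectic form. Let $\mathrm{Symp}^0_0(M)$ be the set of those $h\in\mathrm{Symp}^0(M)$ that fix every point of $M\setminus\check M$, where $\check{\mathbb A}=\mathbb T\times(-1,1)$, $\check{\mathbb D}=\{x: 0<|x|<1\}$ and $\check{\mathbb S}=\mathbb S\setminus\{(0,0,\pm1)\}$. Let $\mathcal F\subset\mathrm{Symp}^0(M)$ be the $C^0$-closure in $\mathrm{Symp}^0(M)$ of $$\{\,h\circ R_\alpha\circ h^{-1} : h\in\mathrm{Symp}^0_0(M),\ \alpha\in\mathbb Q/\mathbb Z\,\}.$$ Then for every $f\in\mathcal F$: $f$ is minimally ergodic, i.e. $f$ has exactly three ergodic invariant Borel probability measures, if and only if $$\mathrm{Conv}(\mathrm{Leb}_M,\mu_1,\mu_{-1})=\mathcal M(f),$$ where $\mathcal M(f)$ is the set of $f$-invariant Borel probability measures on $M$ and $\mathrm{Conv}$ denotes the convex hull. -/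

import Mathlib

open MeasureTheory Set
open scoped Manifold ContDiff NNReal ENNReal

noncomputable section

namespace MinErg

/-- The interval `𝕀 = [-1, 1]`. -/
abbrev I : Type := Icc (-1 : ℝ) 1

/-- The point `1` of `[-1, 1]`. -/
def I.top : I := ⟨1, by norm_num, le_refl _⟩

/-- The point `-1` of `[-1, 1]`. -/
def I.bot : I := ⟨-1, le_refl _, by norm_num⟩

/-- The plane `ℝ²` with its Euclidean norm. -/
abbrev E2 : Type := EuclideanSpace ℝ (Fin 2)

/-- The space `ℝ³` with its Euclidean norm. -/
abbrev E3 : Type := EuclideanSpace ℝ (Fin 3)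

/-- The closed cylinder `𝔸 = 𝕋 × [-1, 1]`, with `𝕋 = ℝ/ℤ`. -/
abbrev Cyl : Type := UnitAddCircle × I

/-- The closed unit disk of `ℝ²`. -/
abbrev Dsk : Type := Metric.closedBall (0 : E2) 1

/-- The unit sphere of `ℝ³`. -/
abbrev Sph : Type := Metric.sphere (0 : E3) 1

/-- The sphere in `ℝ³` is a 2-dimensional manifold (this fact triggers Mathlib's atlas on it). -/
instance factFinrankE3 : Fact (Module.finrank ℝ E3 = 2 + 1) := ⟨by simp⟩

/-- `cos (2πθ)` for `θ ∈ ℝ/ℤ`. -/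
def cosT (θ : UnitAddCircle) : ℝ := (AddCircle.toCircle θ : ℂ).re

/-- `sin (2πθ)` for `θ ∈ ℝ/ℤ`. -/
def sinT (θ : UnitAddCircle) : ℝ := (AddCircle.toCircle θ : ℂ).im

theorem cosT_sq_add_sinT_sq (θ : UnitAddCircle) : cosT θ ^ 2 + sinT θ ^ 2 = 1 := by
  have h := Circle.normSq_coe (AddCircle.toCircle θ)
  rw [Complex.normSq_apply] at h
  unfold cosT sinT
  linarith

theorem cosT_neg (θ : UnitAddCircle) : cosT (-θ) = cosT θ := by
  unfold cosT
  rw [AddCircle.toCircle_neg, Circle.coe_inv_eq_conj, Complex.conj_re]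

theorem sinT_neg (θ : UnitAddCircle) : sinT (-θ) = -sinT θ := by
  unfold sinT
  rw [AddCircle.toCircle_neg, Circle.coe_inv_eq_conj, Complex.conj_im]

theorem mem_disk_iff (x : E2) : x ∈ Metric.closedBall (0 : E2) 1 ↔ x 0 ^ 2 + x 1 ^ 2 ≤ 1 := by
  rw [mem_closedBall_zero_iff, EuclideanSpace.norm_eq, Real.sqrt_le_iff]
  simp [Fin.sum_univ_two]

theorem mem_sphere_iff (x : E3) :
    x ∈ Metric.sphere (0 : E3) 1 ↔ x 0 ^ 2 + x 1 ^ 2 + x 2 ^ 2 = 1 := by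
  rw [mem_sphere_zero_iff_norm, EuclideanSpace.norm_eq, Real.sqrt_eq_one]
  simp [Fin.sum_univ_three]

/-! ### Rotations -/

/-- The rotation of the disk by the angle `2πα`. -/
def rotDskFun (α : UnitAddCircle) (x : Dsk) : Dsk :=
  ⟨!₂[cosT α * x.1 0 - sinT α * x.1 1, sinT α * x.1 0 + cosT α * x.1 1], by
    have h := (mem_disk_iff x.1).1 x.2
    have h1 := cosT_sq_add_sinT_sq α
    rw [mem_disk_iff]
    simp only [Matrix.cons_val_zero, Matrix.cons_val_one]
    have e : (cosT α * x.1 0 - sinT α * x.1 1) ^ 2 + (sinT α * x.1 0 + cosT α * x.1 1) ^ 2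
        = (cosT α ^ 2 + sinT α ^ 2) * (x.1 0 ^ 2 + x.1 1 ^ 2) := by ring
    rw [e, h1, one_mul]
    exact h⟩

/-- The rotation of the sphere by the angle `2πα` about the third axis. -/
def rotSphFun (α : UnitAddCircle) (x : Sph) : Sph :=
  ⟨!₂[cosT α * x.1 0 - sinT α * x.1 1, sinT α * x.1 0 + cosT α * x.1 1, x.1 2], by
    have h := (mem_sphere_iff x.1).1 x.2
    have h1 := cosT_sq_add_sinT_sq α
    rw [mem_sphere_iff]
    simp only [Matrix.cons_val_zero, Matrix.cons_val_one, Matrix.cons_val]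
    have e : (cosT α * x.1 0 - sinT α * x.1 1) ^ 2 + (sinT α * x.1 0 + cosT α * x.1 1) ^ 2
        + x.1 2 ^ 2
        = (cosT α ^ 2 + sinT α ^ 2) * (x.1 0 ^ 2 + x.1 1 ^ 2) + x.1 2 ^ 2 := by ring
    rw [e, h1, one_mul]
    exact h⟩

theorem continuous_rotDskFun (α : UnitAddCircle) : Continuous (rotDskFun α) := by
  unfold rotDskFun
  refine Continuous.subtype_mk ?_ _
  refine (PiLp.continuous_toLp 2 _).comp (continuous_pi fun i => ?_)
  fin_cases i <;> simp <;> fun_prop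

theorem continuous_rotSphFun (α : UnitAddCircle) : Continuous (rotSphFun α) := by
  unfold rotSphFun
  refine Continuous.subtype_mk ?_ _
  refine (PiLp.continuous_toLp 2 _).comp (continuous_pi fun i => ?_)
  fin_cases i <;> simp <;> fun_prop

theorem rotDskFun_neg_rotDskFun (α : UnitAddCircle) (x : Dsk) :
    rotDskFun (-α) (rotDskFun α x) = x := by
  have h1 := cosT_sq_add_sinT_sq α
  apply Subtype.ext
  ext i
  fin_cases i
  · simp only [rotDskFun, cosT_neg, sinT_neg, PiLp.toLp_apply, Fin.zero_eta, Matrix.cons_val_zero,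
      Matrix.cons_val_one]
    linear_combination x.1 0 * h1
  · simp only [rotDskFun, cosT_neg, sinT_neg, PiLp.toLp_apply, Fin.mk_one, Matrix.cons_val_zero,
      Matrix.cons_val_one]
    linear_combination x.1 1 * h1

theorem rotSphFun_neg_rotSphFun (α : UnitAddCircle) (x : Sph) :
    rotSphFun (-α) (rotSphFun α x) = x := by
  have h1 := cosT_sq_add_sinT_sq α
  apply Subtype.ext
  ext i
  fin_cases i
  · simp only [rotSphFun, cosT_neg, sinT_neg, PiLp.toLp_apply, Fin.zero_eta, Matrix.cons_val_zero,
      Matrix.cons_val_one]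
    linear_combination x.1 0 * h1
  · simp only [rotSphFun, cosT_neg, sinT_neg, PiLp.toLp_apply, Fin.mk_one, Matrix.cons_val_zero,
      Matrix.cons_val_one]
    linear_combination x.1 1 * h1
  · simp [rotSphFun]

/-- The rotation `(θ, y) ↦ (θ + α, y)` of the cylinder. -/
def rotCyl (α : UnitAddCircle) : Cyl ≃ₜ Cyl :=
  (Homeomorph.addRight α).prodCongr (Homeomorph.refl I)

/-- The rotation of the disk by `α ∈ ℝ/ℤ`, as a homeomorphism. -/
def rotDsk (α : UnitAddCircle) : Dsk ≃ₜ Dsk where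
  toFun := rotDskFun α
  invFun := rotDskFun (-α)
  left_inv := rotDskFun_neg_rotDskFun α
  right_inv x := by simpa using rotDskFun_neg_rotDskFun (-α) x
  continuous_toFun := continuous_rotDskFun α
  continuous_invFun := continuous_rotDskFun (-α)

/-- The rotation of the sphere by `α ∈ ℝ/ℤ` about the third axis, as a homeomorphism. -/
def rotSph (α : UnitAddCircle) : Sph ≃ₜ Sph where
  toFun := rotSphFun α
  invFun := rotSphFun (-α)
  left_inv := rotSphFun_neg_rotSphFun α
  right_inv x := by simpa using rotSphFun_neg_rotSphFun (-α) x
  continuous_toFun := continuous_rotSphFun α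
  continuous_invFun := continuous_rotSphFun (-α)

/-! ### The parametrization by the cylinder -/

/-- `(θ, y) ↦ √((1+y)/2) (cos 2πθ, sin 2πθ)`, from the cylinder onto the disk. -/
def piDsk (p : Cyl) : Dsk :=
  ⟨!₂[√((1 + p.2.1) / 2) * cosT p.1, √((1 + p.2.1) / 2) * sinT p.1], by
    have h1 := cosT_sq_add_sinT_sq p.1
    have hl := p.2.2.1
    have hu := p.2.2.2
    rw [mem_disk_iff]
    simp only [Matrix.cons_val_zero, Matrix.cons_val_one]
    rw [mul_pow, mul_pow, ← mul_add, h1, Real.sq_sqrt (by linarith)]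
    linarith⟩

/-- `(θ, y) ↦ (√(1-y²) cos 2πθ, √(1-y²) sin 2πθ, y)`, from the cylinder onto the sphere. -/
def piSph (p : Cyl) : Sph :=
  ⟨!₂[√(1 - p.2.1 ^ 2) * cosT p.1, √(1 - p.2.1 ^ 2) * sinT p.1, p.2.1], by
    have h1 := cosT_sq_add_sinT_sq p.1
    have hl := p.2.2.1
    have hu := p.2.2.2
    rw [mem_sphere_iff]
    simp only [Matrix.cons_val_zero, Matrix.cons_val_one, Matrix.cons_val]
    rw [mul_pow, mul_pow, ← mul_add, h1, Real.sq_sqrt (by nlinarith)]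
    ring⟩

/-! ### Symplectic maps of class `C¹` -/

/-- A self-map of the cylinder is of class `C¹` up to the boundary and preserves `dθ ∧ dy`:
it has a lift to the strip `ℝ × [-1, 1]` of class `C¹` with Jacobian determinant `1`. -/
def IsC1SymplecticCyl (f : Cyl → Cyl) : Prop :=
  ∃ F : ℝ × ℝ → ℝ × ℝ,
    ContDiffOn ℝ 1 F (univ ×ˢ Icc (-1) 1) ∧
    (∀ (t : ℝ) (y : I), ((F (t, y.1)).1 : UnitAddCircle) = (f ((t : UnitAddCircle), y)).1 ∧
      (F (t, y.1)).2 = ((f ((t : UnitAddCircle), y)).2 : ℝ)) ∧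
    ∀ p ∈ (univ ×ˢ Icc (-1) 1 : Set (ℝ × ℝ)),
      (fderivWithin ℝ F (univ ×ˢ Icc (-1) 1) p).det = 1

/-- A self-map of the closed disk is of class `C¹` up to the boundary and preserves `dx₁ ∧ dx₂`. -/
def IsC1SymplecticDsk (f : Dsk → Dsk) : Prop :=
  ∃ F : E2 → E2,
    ContDiffOn ℝ 1 F (Metric.closedBall 0 1) ∧
    (∀ x : Dsk, F x.1 = (f x).1) ∧
    ∀ x ∈ Metric.closedBall (0 : E2) 1, (fderivWithin ℝ F (Metric.closedBall 0 1) x).det = 1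

/-- The differential of the inclusion of the sphere in `ℝ³`, sending tangent vectors to vectors. -/
def sphDincl (x : Sph) (u : TangentSpace (𝓡 2) x) : E3 :=
  mvfderiv (𝓡 2) ((↑) : Sph → E3) x u

/-- The area form of the sphere, `Ω_x (u, v) = det (x, u, v)`. -/
def sphForm (x : Sph) (u v : TangentSpace (𝓡 2) x) : ℝ :=
  Matrix.det (Matrix.of ![x.1.ofLp, (sphDincl x u).ofLp, (sphDincl x v).ofLp])

/-- A self-map of the sphere is of class `C¹` and preserves the area form. -/
def IsC1SymplecticSph (f : Sph → Sph) : Prop :=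
  ContMDiff (𝓡 2) (𝓡 2) 1 f ∧
    ∀ (x : Sph) (u v : TangentSpace (𝓡 2) x),
      sphForm (f x) (mfderiv (𝓡 2) (𝓡 2) f x u) (mfderiv (𝓡 2) (𝓡 2) f x v) = sphForm x u v

/-! ### The three surfaces, treated uniformly -/

/-- The three surfaces: the closed cylinder, the closed disk and the sphere. -/
inductive Surface : Type
  | cylinder : Surface
  | disk : Surface
  | sphere : Surface

namespace Surface

/-- The underlying space of a surface. -/
def Carrier : Surface → Type
  | cylinder => Cyl
  | disk => Dsk
  | sphere => Sph

instance instTopologicalSpace : (M : Surface) → TopologicalSpace M.Carrier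
  | cylinder => inferInstanceAs (TopologicalSpace Cyl)
  | disk => inferInstanceAs (TopologicalSpace Dsk)
  | sphere => inferInstanceAs (TopologicalSpace Sph)

instance instMeasurableSpace : (M : Surface) → MeasurableSpace M.Carrier
  | cylinder => inferInstanceAs (MeasurableSpace Cyl)
  | disk => inferInstanceAs (MeasurableSpace Dsk)
  | sphere => inferInstanceAs (MeasurableSpace Sph)

/-- The rotation `R_α` of a surface. -/
def rot : (M : Surface) → UnitAddCircle → (M.Carrier ≃ₜ M.Carrier)
  | cylinder => rotCyl
  | disk => rotDsk
  | sphere => rotSph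

/-- The map `π` from the closed cylinder onto a surface. -/
def proj : (M : Surface) → Cyl → M.Carrier
  | cylinder => id
  | disk => piDsk
  | sphere => piSph

/-- The surface deprived of its boundary, of the center (disk) and of the poles (sphere). -/
def punctured : (M : Surface) → Set M.Carrier
  | cylinder => {p : Cyl | p.2.1 ∈ Ioo (-1 : ℝ) 1}
  | disk => {x : Dsk | 0 < x.1 0 ^ 2 + x.1 1 ^ 2 ∧ x.1 0 ^ 2 + x.1 1 ^ 2 < 1}
  | sphere => {x : Sph | x.1 ≠ !₂[0, 0, 1] ∧ x.1 ≠ !₂[0, 0, -1]}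

/-- The area measure: length times length, Lebesgue measure of the plane, surface measure. -/
def area : (M : Surface) → Measure M.Carrier
  | cylinder => (volume : Measure UnitAddCircle).prod
      ((volume : Measure ℝ).comap ((↑) : I → ℝ))
  | disk => (volume : Measure E2).comap ((↑) : Dsk → E2)
  | sphere => (volume : Measure E3).toSphere

/-- The normalized area measure `Leb_M`. -/
def leb (M : Surface) : Measure M.Carrier := (M.area univ)⁻¹ • M.area

/-- `μ_y = π_* Leb_{𝕋 × {y}}`, the uniform measure on the image of the circle `𝕋 × {y}`. -/
def circleMeasure (M : Surface) (y : I) : Measure M.Carrier :=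
  (volume : Measure UnitAddCircle).map fun θ => M.proj (θ, y)

/-- Self-maps of class `C¹` that preserve the symplectic form. -/
def IsC1Symplectic : (M : Surface) → (M.Carrier → M.Carrier) → Prop
  | cylinder => IsC1SymplecticCyl
  | disk => IsC1SymplecticDsk
  | sphere => IsC1SymplecticSph

/-- `Symp¹(M)`: the `C¹`-diffeomorphisms that preserve the symplectic form. -/
def symp1 (M : Surface) : Set (M.Carrier ≃ₜ M.Carrier) :=
  {f | M.IsC1Symplectic f ∧ M.IsC1Symplectic f.symm}

end Surface

/-- The closure of a set of homeomorphisms, among the homeomorphisms, in the `C⁰` topology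
(the compact-open topology, that is uniform convergence when the space is compact). -/
def c0Closure {X : Type*} [TopologicalSpace X] (S : Set (X ≃ₜ X)) : Set (X ≃ₜ X) :=
  {f | (f : C(X, X)) ∈ closure ((fun g : X ≃ₜ X => (g : C(X, X))) '' S)}

namespace Surface

/-- `Symp⁰(M)`: the symplectic homeomorphisms, the `C⁰` closure of `Symp¹(M)`. -/
def symp0 (M : Surface) : Set (M.Carrier ≃ₜ M.Carrier) := c0Closure M.symp1

/-- The symplectic homeomorphisms that fix every point outside the punctured surface. -/
def symp0Fix (M : Surface) : Set (M.Carrier ≃ₜ M.Carrier) :=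
  {f | f ∈ M.symp0 ∧ ∀ x ∉ M.punctured, f x = x}

/-- The conjugates `h ∘ R_α ∘ h⁻¹` of the rational rotations by elements of `symp0Fix`. -/
def rationalConjugates (M : Surface) : Set (M.Carrier ≃ₜ M.Carrier) :=
  {g | ∃ h ∈ M.symp0Fix, ∃ r : ℚ, ∀ x, g x = h (M.rot ((r : ℝ) : UnitAddCircle) (h.symm x))}

/-- The class of symplectic homeomorphisms that are `C⁰` limits of conjugates of rational
rotations. -/
def limitClass (M : Surface) : Set (M.Carrier ≃ₜ M.Carrier) :=
  M.symp0 ∩ c0Closure M.rationalConjugates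

end Surface

/-- The set of the invariant Borel probability measures of a map. -/
def invariantMeasures {X : Type*} [MeasurableSpace X] (f : X → X) : Set (Measure X) :=
  {μ | IsProbabilityMeasure μ ∧ MeasurePreserving f μ μ}

/-- The set of the ergodic invariant Borel probability measures of a map. -/
def ergodicMeasures {X : Type*} [MeasurableSpace X] (f : X → X) : Set (Measure X) :=
  {μ | IsProbabilityMeasure μ ∧ Ergodic f μ}

/-- A map is minimally ergodic if it has exactly three ergodic measures. -/
def IsMinimallyErgodic {X : Type*} [MeasurableSpace X] (f : X → X) : Prop :=
  (ergodicMeasures f).encard = 3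

end MinErg

end

namespace MinErg

open Filter Topology BoundedContinuousFunction

/-! ### Invariant measures and ergodic measures -/

section ErgodicDecomposition

variable {X : Type*} [MeasurableSpace X]

/-! The three measures `leb`, μ₁, μ₋₁ are invariant and live on three disjoint Borel sets covering
`M` (`strata`: the punctured surface and the levels ±1 of `height`), and every ergodic measure gives
each stratum mass 0 or 1. The rest is convex geometry, collected in `encard_ergodicMeasures_eq_iff`.
If the hull of the three measures is all of `M(f)`, a measure of the hull carried by one stratum
must be the vertex living there. So every ergodic measure is a vertex, and every vertex is extreme,
hence ergodic. Conversely, finitely many ergodic measures span `M(f)` by Krein–Milman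
(`invariantMeasures_eq_convexHull`). Each stratum must then carry an ergodic measure, for otherwise
it would be null for all of `M(f)`; with only three available there is exactly one per stratum, and
it equals the given invariant measure there. Invariance rests on `isClosed_measurePreserving`:
preserving a fixed measure is a `C⁰`-closed condition. For `leb` this reduces to `C¹` symplectic
maps, handled by the change of variables formula on each surface. For μ±₁ it reduces to conjugates
of rotations, which coincide with rotations on the levels ±1 because the conjugating map fixes them
pointwise. -/

theorem convex_invariantMeasures (f : X → X) : Convex ℝ≥0 (invariantMeasures f) := by
  rintro μ ⟨hμ, hfμ⟩ ν ⟨hν, hfν⟩ a b - - hab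
  refine ⟨⟨?_⟩, hfμ.measurable, ?_⟩
  · have h : (a : ℝ≥0∞) + b = 1 := by exact_mod_cast hab
    simp only [Measure.add_apply, Measure.smul_apply, measure_univ, ENNReal.smul_def, smul_eq_mul,
      mul_one, h]
  · rw [Measure.map_add _ _ hfμ.measurable, Measure.map_smul, Measure.map_smul, hfμ.map_eq,
      hfν.map_eq]

variable [TopologicalSpace X]

/-- A measure, as the functional that it defines on the bounded continuous functions. -/
noncomputable def integralFunctional (μ : Measure X) (g : X →ᵇ ℝ) : ℝ := ∫ x, g x ∂μ

variable [BorelSpace X]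

theorem integralFunctional_add_smul {μ ν : Measure X} [IsFiniteMeasure μ] [IsFiniteMeasure ν]
    (a b : ℝ≥0) :
    integralFunctional (a • μ + b • ν) =
      (a : ℝ) • integralFunctional μ + (b : ℝ) • integralFunctional ν := by
  funext g
  simp only [integralFunctional, Pi.add_apply, Pi.smul_apply]
  rw [integral_add_measure (g.integrable _) (g.integrable _), integral_smul_nnreal_measure,
    integral_smul_nnreal_measure]
  rfl

/-- Measures only form an `ℝ≥0`-module, whereas Krein–Milman needs a real locally convex space; this
is the passage from one to the other. -/
theorem convex_image_integralFunctional {C : Set (Measure X)} (hC : Convex ℝ≥0 C)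
    (hfin : ∀ μ ∈ C, IsFiniteMeasure μ) : Convex ℝ (integralFunctional '' C) := by
  rintro _ ⟨μ, hμ, rfl⟩ _ ⟨ν, hν, rfl⟩ a b ha hb hab
  have := hfin μ hμ
  have := hfin ν hν
  lift a to ℝ≥0 using ha
  lift b to ℝ≥0 using hb
  exact ⟨a • μ + b • ν, hC hμ hν a.2 b.2 (by exact_mod_cast hab), integralFunctional_add_smul a b⟩

theorem continuous_integralFunctional :
    Continuous fun μ : ProbabilityMeasure X => integralFunctional (μ : Measure X) :=
  continuous_pi fun g => ProbabilityMeasure.continuous_integral_boundedContinuousFunction g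

variable [HasOuterApproxClosed X]

theorem eq_of_integralFunctional_eq {μ ν : Measure X} [IsFiniteMeasure μ] [IsFiniteMeasure ν]
    (h : integralFunctional μ = integralFunctional ν) : μ = ν :=
  ext_of_forall_integral_eq_of_IsFiniteMeasure fun g => congrFun h g

/-- Extreme invariant measures are ergodic; since `integralFunctional` is injective on finite
measures, extremality can be tested on functionals. -/
theorem ergodic_of_integralFunctional_mem_extremePoints {f : X → X} {μ : Measure X}
    (hμ : μ ∈ invariantMeasures f)
    (h : integralFunctional μ ∈ (integralFunctional '' invariantMeasures f).extremePoints ℝ) :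
    Ergodic f μ := by
  refine Ergodic.of_mem_extremePoints ⟨⟨hμ.2, hμ.1⟩, ?_⟩
  rintro ν₁ ⟨hf₁, hν₁⟩ ν₂ ⟨hf₂, hν₂⟩ ⟨a, b, ha, hb, hab, rfl⟩
  have := hμ.1
  -- The segment has weights in `ℝ≥0∞`; they sum to 1, so they are finite.
  have ha' : a ≠ ⊤ := ne_top_of_le_ne_top ENNReal.one_ne_top (hab ▸ le_self_add)
  have hb' : b ≠ ⊤ := ne_top_of_le_ne_top ENNReal.one_ne_top (hab ▸ le_add_self)
  lift a to ℝ≥0 using ha'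
  lift b to ℝ≥0 using hb'
  refine eq_of_integralFunctional_eq (h.2 ⟨ν₁, ⟨hν₁, hf₁⟩, rfl⟩ ⟨ν₂, ⟨hν₂, hf₂⟩, rfl⟩
    ⟨a, b, by exact_mod_cast ha, by exact_mod_cast hb, by exact_mod_cast hab, ?_⟩)
  exact (integralFunctional_add_smul a b).symm

/-- Invariance amounts to the equations ∫ g ∘ f = ∫ g over bounded continuous g, each closed in the
weak topology. -/
theorem isClosed_invariant {f : X → X} (hf : Continuous f) :
    IsClosed {μ : ProbabilityMeasure X | MeasurePreserving f (μ : Measure X) μ} := by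
  have h : {μ : ProbabilityMeasure X | MeasurePreserving f (μ : Measure X) μ} =
      ⋂ g : X →ᵇ ℝ, {μ : ProbabilityMeasure X |
        integralFunctional (μ : Measure X) (g.compContinuous ⟨f, hf⟩) =
        integralFunctional (μ : Measure X) g} := by
    ext μ
    have key (g : X →ᵇ ℝ) : integralFunctional (μ : Measure X) (g.compContinuous ⟨f, hf⟩) =
        integralFunctional ((μ : Measure X).map f) g := by
      rw [integralFunctional, integralFunctional,
        integral_map hf.aemeasurable g.continuous.aestronglyMeasurable]
      rfl
    simp only [mem_ofPred_eq, mem_iInter, key]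
    refine ⟨fun h g => by rw [h.map_eq], fun h => ⟨hf.measurable, ?_⟩⟩
    have := Measure.isProbabilityMeasure_map (μ := (μ : Measure X)) hf.aemeasurable
    exact eq_of_integralFunctional_eq (funext h)
  rw [h]
  exact isClosed_iInter fun g => isClosed_eq (continuous_pi_iff.1 continuous_integralFunctional _)
    (continuous_pi_iff.1 continuous_integralFunctional g)

theorem isCompact_image_integralFunctional [T2Space X] [CompactSpace X] {f : X → X}
    (hf : Continuous f) : IsCompact (integralFunctional '' invariantMeasures f) := by
  have h : integralFunctional '' invariantMeasures f =
      (fun μ : ProbabilityMeasure X => integralFunctional (μ : Measure X)) ''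
        {μ | MeasurePreserving f (μ : Measure X) μ} := by
    ext φ
    constructor
    · rintro ⟨μ, ⟨hμ, hfμ⟩, rfl⟩
      exact ⟨⟨μ, hμ⟩, hfμ, rfl⟩
    · rintro ⟨μ, hμ, rfl⟩
      exact ⟨μ, ⟨μ.2, hμ⟩, rfl⟩
  rw [h]
  exact (isClosed_invariant hf).isCompact.image continuous_integralFunctional

/-- If a continuous map of a compact space has finitely many ergodic measures, then every invariant
probability measure is a convex combination of them. -/
theorem invariantMeasures_eq_convexHull [T2Space X] [CompactSpace X] {f : X → X}
    (hf : Continuous f) (hfin : (ergodicMeasures f).Finite) :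
    invariantMeasures f = convexHull ℝ≥0 (ergodicMeasures f) := by
  have hsub : convexHull ℝ≥0 (ergodicMeasures f) ⊆ invariantMeasures f :=
    convexHull_min (fun μ hμ => ⟨hμ.1, hμ.2.toMeasurePreserving⟩) (convex_invariantMeasures f)
  refine Subset.antisymm (fun μ hμ => ?_) hsub
  have hext : (integralFunctional '' invariantMeasures f).extremePoints ℝ ⊆
      integralFunctional '' ergodicMeasures f := by
    intro φ hφ
    obtain ⟨ν, hν, rfl⟩ := hφ.1
    exact ⟨ν, ⟨hν.1, ergodic_of_integralFunctional_mem_extremePoints hν hφ⟩, rfl⟩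
  have hconv : Convex ℝ (integralFunctional '' invariantMeasures f) :=
    convex_image_integralFunctional (convex_invariantMeasures f) fun ν hν => by
      have := hν.1; infer_instance
  have h : integralFunctional μ ∈ convexHull ℝ (integralFunctional '' ergodicMeasures f) := by
    -- Krein–Milman gives only a closed convex hull; finiteness makes the plain hull closed already.
    refine closure_minimal (convexHull_mono hext) ((hfin.image _).isClosed_convexHull ℝ) ?_
    rw [closure_convexHull_extremePoints (isCompact_image_integralFunctional hf) hconv]
    exact mem_image_of_mem _ hμ
  have h2 : integralFunctional μ ∈ integralFunctional '' convexHull ℝ≥0 (ergodicMeasures f) :=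
    convexHull_min (image_mono (subset_convexHull _ _))
      (convex_image_integralFunctional (convex_convexHull _ _) fun ν hν => by
        have := (hsub hν).1; infer_instance) h
  obtain ⟨ν, hν, hνμ⟩ := h2
  have := (hsub hν).1
  have := hμ.1
  rwa [← eq_of_integralFunctional_eq hνμ]

end ErgodicDecomposition

/-! ### Families of measures that live on disjoint sets -/

section Separated

variable {X ι : Type*} [MeasurableSpace X] [DecidableEq ι]

theorem measure_eq_ite {A : ι → Set X} (hA : ∀ i, MeasurableSet (A i))
    (hdisj : Pairwise fun i j => Disjoint (A i) (A j)) {e : ι → Measure X}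
    (hprob : ∀ i, IsProbabilityMeasure (e i)) (he : ∀ i, e i (A i) = 1) (i j : ι) :
    e i (A j) = if i = j then 1 else 0 := by
  split_ifs with h
  · exact h ▸ he i
  · have := hprob i
    exact measure_mono_null (hdisj h).subset_compl_left ((prob_compl_eq_zero_iff (hA i)).2 (he i))

theorem exists_measure_eq_one {X ι : Type*} [MeasurableSpace X] [Countable ι]
    {A : ι → Set X} (hcover : ⋃ i, A i = univ) {μ : Measure X}
    [IsProbabilityMeasure μ] (h : ∀ i, μ (A i) = 0 ∨ μ (A i) = 1) : ∃ i, μ (A i) = 1 := by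
  by_contra! hne
  have h0 : μ (⋃ i, A i) = 0 := measure_iUnion_null fun i => (h i).resolve_right (hne i)
  rw [hcover, measure_univ] at h0
  exact one_ne_zero h0

variable [Fintype ι]

/-- The identity is linear in `ν` and holds at the vertices, so the weights of a convex combination
are its masses on the sets `A j`. -/
theorem eq_sum_of_mem_convexHull {e : ι → Measure X} {A : ι → Set X}
    (he : ∀ i j, e i (A j) = if i = j then 1 else 0) {ν : Measure X}
    (hν : ν ∈ convexHull ℝ≥0 (range e)) : ν = ∑ j, ν (A j) • e j := by
  refine convexHull_min (t := {ν : Measure X | ν = ∑ j, ν (A j) • e j}) ?_ ?_ hν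
  · rintro _ ⟨i, rfl⟩
    simp [he]
  · rintro μ hμ ν hν a b - - -
    simp only [mem_ofPred_eq] at hμ hν ⊢
    conv_lhs => rw [hμ, hν]
    simp only [Measure.add_apply, Measure.smul_apply, add_smul, Finset.sum_add_distrib,
      Finset.smul_sum, smul_assoc]

theorem eq_of_mem_convexHull {e : ι → Measure X} {A : ι → Set X}
    (he : ∀ i j, e i (A j) = if i = j then 1 else 0) {ν : Measure X}
    (hν : ν ∈ convexHull ℝ≥0 (range e)) {i : ι} (hi : ν (A i) = 1)
    (h : ∀ j, j ≠ i → ν (A j) = 0) : ν = e i := by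
  rw [eq_sum_of_mem_convexHull he hν, Finset.sum_eq_single i (fun j _ hj => by simp [h j hj])
    (fun h => absurd (Finset.mem_univ i) h), hi, one_smul]

variable {f : X → X} {m : ι → Measure X} {A : ι → Set X}

theorem ergodicMeasures_eq_range_of_convexHull (hA : ∀ i, MeasurableSet (A i))
    (hdisj : Pairwise fun i j => Disjoint (A i) (A j)) (hcover : ⋃ i, A i = univ)
    (hm : ∀ i, m i ∈ invariantMeasures f) (hmA : ∀ i, m i (A i) = 1)
    (herg : ∀ μ ∈ ergodicMeasures f, ∀ i, μ (A i) = 0 ∨ μ (A i) = 1)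
    (h : convexHull ℝ≥0 (range m) = invariantMeasures f) : ergodicMeasures f = range m := by
  have hite := measure_eq_ite hA hdisj (fun i => (hm i).1) hmA
  refine Subset.antisymm (fun μ hμ => ?_) ?_
  · have := hμ.1
    obtain ⟨i, hi⟩ := exists_measure_eq_one hcover (herg μ hμ)
    have hμ' : μ ∈ convexHull ℝ≥0 (range m) := h ▸ ⟨hμ.1, hμ.2.toMeasurePreserving⟩
    refine ⟨i, (eq_of_mem_convexHull hite hμ' hi fun j hj => ?_).symm⟩
    exact measure_mono_null (hdisj hj.symm).subset_compl_left
      ((prob_compl_eq_zero_iff (hA i)).2 hi)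
  · rintro _ ⟨i, rfl⟩
    refine ⟨(hm i).1, Ergodic.of_mem_extremePoints
      ((mem_extremePoints_iff_left).2 ⟨⟨(hm i).2, (hm i).1⟩, ?_⟩)⟩
    rintro ν₁ ⟨hf₁, hν₁⟩ ν₂ - ⟨a, b, ha, -, -, hab⟩
    have hν₁' : ν₁ ∈ convexHull ℝ≥0 (range m) := h ▸ ⟨hν₁, hf₁⟩
    -- A component with positive weight is null wherever `m i` is, so it is carried by `A i` and
    -- must be the vertex `m i`.
    have h0 : ν₁ (A i)ᶜ = 0 := by
      have := (hm i).1
      have h1 := (prob_compl_eq_zero_iff (μ := m i) (hA i)).2 (hmA i)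
      rw [← hab] at h1
      exact (by simpa [ha.ne'] using h1 : _ ∧ _).1
    exact eq_of_mem_convexHull hite hν₁' ((prob_compl_eq_zero_iff (hA i)).1 h0) fun j hj =>
      measure_mono_null (hdisj hj.symm).subset_compl_left h0

theorem ergodicMeasures_eq_range_of_encard (hA : ∀ i, MeasurableSet (A i))
    (hdisj : Pairwise fun i j => Disjoint (A i) (A j))
    (hm : ∀ i, m i ∈ invariantMeasures f) (hmA : ∀ i, m i (A i) = 1)
    (herg : ∀ μ ∈ ergodicMeasures f, ∀ i, μ (A i) = 0 ∨ μ (A i) = 1)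
    (h : invariantMeasures f = convexHull ℝ≥0 (ergodicMeasures f))
    (hcard : (ergodicMeasures f).encard = Fintype.card ι) : ergodicMeasures f = range m := by
  -- If every ergodic measure ignored `A i`, so would their whole convex hull, which contains `m i`.
  have hex (i : ι) : ∃ e ∈ ergodicMeasures f, e (A i) = 1 := by
    by_contra! hne
    have h0 : m i ∈ {ν : Measure X | ν (A i) = 0} := by
      refine convexHull_min (t := {ν : Measure X | ν (A i) = 0})
        (fun e he => (herg e he i).resolve_right (hne e he)) ?_ (h ▸ hm i)
      rintro μ hμ ν hν a b - - -
      simp_all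
    have h1 := hmA i
    rw [show m i (A i) = 0 from h0] at h1
    exact zero_ne_one h1
  choose e he heA using hex
  have hite := measure_eq_ite hA hdisj (fun i => (he i).1) heA
  have hinj : Function.Injective e := fun i j hij => by
    by_contra hne
    have h1 := hite i j
    rw [hij, heA, if_neg hne] at h1
    exact one_ne_zero h1
  -- The `e i` are distinct and as numerous as the ergodic measures, so they exhaust them.
  have hrange : range e = ergodicMeasures f := by
    refine (finite_range e).eq_of_subset_of_encard_le (range_subset_iff.2 he) ?_
    rw [hcard, ← image_univ, hinj.encard_image, encard_univ, ENat.card_eq_coe_fintype_card]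
  rw [← hrange]
  congr 1
  funext i
  refine (eq_of_mem_convexHull hite (hrange ▸ h ▸ hm i) (hmA i) fun j hj => ?_).symm
  rw [measure_eq_ite hA hdisj (fun i => (hm i).1) hmA, if_neg hj.symm]

theorem encard_ergodicMeasures_eq_iff [TopologicalSpace X] [BorelSpace X] [HasOuterApproxClosed X]
    [T2Space X] [CompactSpace X] (hf : Continuous f) (hA : ∀ i, MeasurableSet (A i))
    (hdisj : Pairwise fun i j => Disjoint (A i) (A j)) (hcover : ⋃ i, A i = univ)
    (hm : ∀ i, m i ∈ invariantMeasures f) (hmA : ∀ i, m i (A i) = 1)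
    (herg : ∀ μ ∈ ergodicMeasures f, ∀ i, μ (A i) = 0 ∨ μ (A i) = 1) :
    (ergodicMeasures f).encard = Fintype.card ι ↔
      convexHull ℝ≥0 (range m) = invariantMeasures f := by
  constructor
  · intro hcard
    have h := invariantMeasures_eq_convexHull hf (Set.finite_of_encard_eq_coe hcard)
    rw [h, ergodicMeasures_eq_range_of_encard hA hdisj hm hmA herg h hcard]
  · intro h
    have hinj : Function.Injective m := fun i j hij => by
      by_contra hne
      have h1 := measure_eq_ite hA hdisj (fun i => (hm i).1) hmA i j
      rw [hij, hmA, if_neg hne] at h1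
      exact one_ne_zero h1
    rw [ergodicMeasures_eq_range_of_convexHull hA hdisj hcover hm hmA herg h, ← image_univ,
      hinj.encard_image, encard_univ, ENat.card_eq_coe_fintype_card]

end Separated

/-! ### Limits of measure preserving maps -/

section Limits

variable {X : Type*} [TopologicalSpace X] [CompactSpace X] [MeasurableSpace X] [BorelSpace X]

/-- For fixed g, the map h ↦ ∫ g ∘ h dμ is continuous: postcomposition with g is continuous on `C(X,
X)`, and integration on `C(X, ℝ)` factors through `L¹`. -/
theorem isClosed_measurePreserving [HasOuterApproxClosed X] (μ : Measure X) [IsFiniteMeasure μ] :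
    IsClosed {h : C(X, X) | MeasurePreserving h μ μ} := by
  have key (g : X →ᵇ ℝ) (h : C(X, X)) :
      ∫ x, g x ∂(μ.map h) = ∫ x, g (h x) ∂μ :=
    integral_map h.continuous.aemeasurable g.continuous.aestronglyMeasurable
  have h : {h : C(X, X) | MeasurePreserving h μ μ} =
      ⋂ g : X →ᵇ ℝ, {h : C(X, X) | ∫ x, g (h x) ∂μ = ∫ x, g x ∂μ} := by
    ext h
    simp only [mem_ofPred_eq, mem_iInter, ← key]
    refine ⟨fun hh g => by rw [hh.map_eq], fun hh => ⟨h.continuous.measurable, ?_⟩⟩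
    exact ext_of_forall_integral_eq_of_IsFiniteMeasure hh
  rw [h]
  refine isClosed_iInter fun g => isClosed_eq ?_ continuous_const
  have hc : Continuous fun h : C(X, X) => (g : C(X, ℝ)).comp h :=
    ContinuousMap.continuous_postcomp _
  have hint (φ : C(X, ℝ)) : ∫ x, φ x ∂μ = ∫ x, ContinuousMap.toLp 1 μ ℝ φ x ∂μ :=
    (integral_congr_ae (ContinuousMap.coeFn_toLp μ φ)).symm
  have hL : Continuous fun φ : C(X, ℝ) => ∫ x, φ x ∂μ := by
    simp only [hint]
    exact continuous_integral.comp (ContinuousMap.toLp 1 μ ℝ).continuous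
  exact hL.comp hc

theorem mem_of_mem_c0Closure {X : Type*} [TopologicalSpace X] {S : Set (X ≃ₜ X)} {T : Set C(X, X)}
    (hT : IsClosed T)
    (hST : ∀ g ∈ S, (g : C(X, X)) ∈ T) {f : X ≃ₜ X} (hf : f ∈ c0Closure S) : (f : C(X, X)) ∈ T :=
  closure_minimal (by rintro _ ⟨g, hg, rfl⟩; exact hST g hg) hT hf

end Limits

/-! ### Area preservation: the disk -/

/-- Change of variables for `F` on `f ⁻¹' B`, with Jacobian 1. The derivative within the closed ball
suffices, so the boundary needs no separate treatment. -/
theorem measurePreserving_of_isC1SymplecticDsk {f : Dsk ≃ₜ Dsk} (hf : IsC1SymplecticDsk f) :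
    MeasurePreserving f ((volume : Measure E2).comap ((↑) : Dsk → E2))
      ((volume : Measure E2).comap ((↑) : Dsk → E2)) := by
  obtain ⟨F, hF, hFf, hdet⟩ := hf
  have hme : MeasurableEmbedding ((↑) : Dsk → E2) :=
    MeasurableEmbedding.subtype_coe Metric.isClosed_closedBall.measurableSet
  refine ⟨f.continuous.measurable, ?_⟩
  ext B hB
  have hfB : MeasurableSet (f ⁻¹' B) := f.continuous.measurable hB
  rw [Measure.map_apply f.continuous.measurable hB, hme.comap_apply, hme.comap_apply]
  have himage : ((↑) : Dsk → E2) '' B = F '' (((↑) : Dsk → E2) '' (f ⁻¹' B)) := by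
    rw [image_image, ← f.image_symm, image_image]
    simp [hFf]
  have hsub : ((↑) : Dsk → E2) '' (f ⁻¹' B) ⊆ Metric.closedBall 0 1 := by
    rintro _ ⟨x, -, rfl⟩
    exact x.2
  have hinj : InjOn F (((↑) : Dsk → E2) '' (f ⁻¹' B)) := by
    rintro _ ⟨x, -, rfl⟩ _ ⟨y, -, rfl⟩ hxy
    rw [hFf, hFf] at hxy
    rw [f.injective (Subtype.ext hxy)]
  have hder : ∀ x ∈ ((↑) : Dsk → E2) '' (f ⁻¹' B), HasFDerivWithinAt F
      (fderivWithin ℝ F (Metric.closedBall 0 1) x) (((↑) : Dsk → E2) '' (f ⁻¹' B)) x := fun x hx =>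
    ((hF.differentiableOn one_ne_zero x (hsub hx)).hasFDerivWithinAt).mono hsub
  rw [himage, ← lintegral_abs_det_fderiv_eq_addHaar_image volume
    (hme.measurableSet_image.2 hfB) hder hinj,
    setLIntegral_congr_fun (g := fun _ => 1) (hme.measurableSet_image.2 hfB) fun x hx => by
      simp [hdet x (hsub hx)]]
  simp

/-! ### Area preservation: the cylinder -/

/-- The covering map from the plane onto the infinite cylinder. -/
def planeProj (p : ℝ × ℝ) : UnitAddCircle × ℝ := ((p.1 : UnitAddCircle), p.2)

theorem measurable_planeProj : Measurable planeProj :=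
  (AddCircle.measurable_mk'.comp measurable_fst).prodMk measurable_snd

theorem measurePreserving_planeProj (t : ℝ) :
    MeasurePreserving planeProj (volume.restrict (Ioc t (t + 1) ×ˢ univ)) volume := by
  have h := (UnitAddCircle.measurePreserving_mk t).prod
    (MeasurePreserving.id (volume : Measure ℝ))
  have h2 : (volume.restrict (Ioc t (t + 1) ×ˢ univ) : Measure (ℝ × ℝ)) =
      (volume.restrict (Ioc t (t + 1))).prod volume := by
    rw [Measure.volume_eq_prod, ← Measure.prod_restrict, Measure.restrict_univ]
  rw [h2]
  exact h

theorem injOn_planeProj (t : ℝ) : InjOn planeProj (Ioc t (t + 1) ×ˢ univ) := by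
  rintro ⟨x, y⟩ hx ⟨x', y'⟩ hx' h
  simp only [planeProj, Prod.mk.injEq] at h
  exact Prod.ext ((AddCircle.coe_eq_coe_iff_of_mem_Ioc hx.1 hx'.1).1 h.1) h.2

theorem surjOn_planeProj (t : ℝ) : SurjOn planeProj (Ioc t (t + 1) ×ˢ univ) univ := by
  rintro ⟨θ, y⟩ -
  obtain ⟨x, hx, rfl⟩ : θ ∈ ((↑) : ℝ → UnitAddCircle) '' Ioc t (t + 1) :=
    AddCircle.coe_image_Ioc_eq (1 : ℝ) t ▸ mem_univ θ
  exact ⟨(x, y), ⟨hx, mem_univ _⟩, rfl⟩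

/-- Cut `T` into vertical strips of width 1: the covering preserves area on each strip, and
injectivity on `T` keeps the images of the pieces disjoint. -/
theorem volume_image_planeProj_of_injOn {T : Set (ℝ × ℝ)} (hT : MeasurableSet T)
    (hinj : InjOn planeProj T) : volume (planeProj '' T) = volume T := by
  have hD (n : ℤ) : MeasurableSet (Ioc (n : ℝ) (n + 1) ×ˢ (univ : Set ℝ)) :=
    measurableSet_Ioc.prod .univ
  have hTn (n : ℤ) : MeasurableSet (T ∩ Ioc (n : ℝ) (n + 1) ×ˢ univ) := hT.inter (hD n)
  have hcover : ⋃ n : ℤ, T ∩ Ioc (n : ℝ) (n + 1) ×ˢ univ = T := by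
    rw [← inter_iUnion, ← iUnion_prod_const, iUnion_Ioc_intCast, univ_prod_univ, inter_univ]
  have hdisj : Pairwise fun m n : ℤ =>
      Disjoint (T ∩ Ioc (m : ℝ) (m + 1) ×ˢ univ) (T ∩ Ioc (n : ℝ) (n + 1) ×ˢ univ) := fun m n hmn =>
    ((pairwise_disjoint_Ioc_intCast ℝ hmn).set_prod_left _ _).mono inter_subset_right
      inter_subset_right
  have himage (n : ℤ) : MeasurableSet (planeProj '' (T ∩ Ioc (n : ℝ) (n + 1) ×ˢ univ)) :=
    (hTn n).image_of_measurable_injOn measurable_planeProj (hinj.mono inter_subset_left)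
  have hvol (n : ℤ) : volume (planeProj '' (T ∩ Ioc (n : ℝ) (n + 1) ×ˢ univ)) =
      volume (T ∩ Ioc (n : ℝ) (n + 1) ×ˢ univ) := by
    rw [← (measurePreserving_planeProj n).measure_preimage (himage n).nullMeasurableSet,
      Measure.restrict_apply (measurable_planeProj (himage n))]
    congr 1
    ext p
    constructor
    · rintro ⟨⟨q, hq, hqp⟩, hp⟩
      rwa [← injOn_planeProj n hq.2 hp hqp]
    · exact fun hp => ⟨mem_image_of_mem _ hp, hp.2⟩
  calc volume (planeProj '' T)
      = volume (⋃ n : ℤ, planeProj '' (T ∩ Ioc (n : ℝ) (n + 1) ×ˢ univ)) := by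
        rw [← image_iUnion, hcover]
    _ = ∑' n : ℤ, volume (planeProj '' (T ∩ Ioc (n : ℝ) (n + 1) ×ˢ univ)) :=
        measure_iUnion (fun m n hmn => disjoint_image_image fun p hp q hq h =>
          disjoint_left.1 (hdisj hmn) hp (hinj hp.1 hq.1 h ▸ hq)) himage
    _ = ∑' n : ℤ, volume (T ∩ Ioc (n : ℝ) (n + 1) ×ˢ univ) := by simp only [hvol]
    _ = volume T := by rw [← measure_iUnion hdisj hTn, hcover]

/-- The inclusion of the closed cylinder in the infinite cylinder. -/
def cylIncl (c : Cyl) : UnitAddCircle × ℝ := (c.1, c.2)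

theorem measurableEmbedding_cylIncl : MeasurableEmbedding cylIncl :=
  MeasurableEmbedding.id.prodMap (MeasurableEmbedding.subtype_coe measurableSet_Icc)

/-- The area measure of the closed cylinder. -/
noncomputable def cylArea : Measure Cyl :=
  (volume : Measure UnitAddCircle).prod ((volume : Measure ℝ).comap ((↑) : I → ℝ))

theorem comap_volume_univ : (volume : Measure ℝ).comap ((↑) : I → ℝ) univ = 2 := by
  rw [comap_subtype_coe_apply measurableSet_Icc, image_univ, Subtype.range_coe, Real.volume_Icc]
  norm_num

instance : IsFiniteMeasure ((volume : Measure ℝ).comap ((↑) : I → ℝ)) :=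
  ⟨by simp [comap_volume_univ]⟩

theorem cylArea_univ : cylArea univ = 2 := by
  rw [cylArea, ← univ_prod_univ, Measure.prod_prod, comap_volume_univ, UnitAddCircle.measure_univ,
    one_mul]

theorem cylArea_apply (B : Set Cyl) :
    cylArea B = volume (cylIncl '' B) := by
  have h : Measure.map cylIncl cylArea =
      volume.restrict (univ ×ˢ Icc (-1 : ℝ) 1) := by
    have h2 : cylIncl = Prod.map id ((↑) : I → ℝ) := rfl
    rw [cylArea, h2, ← Measure.map_prod_map _ _ measurable_id measurable_subtype_coe,
      Measure.map_id,
      map_comap_subtype_coe measurableSet_Icc, Measure.volume_eq_prod, ← Measure.prod_restrict,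
      Measure.restrict_univ]
  have hsub : cylIncl '' B ⊆ univ ×ˢ Icc (-1 : ℝ) 1 := by
    rintro _ ⟨c, -, rfl⟩
    exact ⟨mem_univ _, c.2.2⟩
  rw [← Measure.restrict_eq_self volume hsub, ← h, measurableEmbedding_cylIncl.map_apply,
    preimage_image_eq _ measurableEmbedding_cylIncl.injective]

theorem measurePreserving_of_isC1SymplecticCyl {f : Cyl ≃ₜ Cyl} (hf : IsC1SymplecticCyl f) :
    MeasurePreserving f cylArea cylArea := by
  obtain ⟨F, hF, hFf, hdet⟩ := hf
  have hinc := measurableEmbedding_cylIncl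
  refine ⟨f.continuous.measurable, ?_⟩
  ext B hB
  have hfB : MeasurableSet (f ⁻¹' B) := f.continuous.measurable hB
  rw [Measure.map_apply f.continuous.measurable hB, cylArea_apply, cylArea_apply]
  -- `S` is the copy of `f ⁻¹' B` in one fundamental domain. Its image `F '' S` may leave that
  -- domain, but the covering is still injective on it because `f` is injective.
  set S : Set (ℝ × ℝ) := planeProj ⁻¹' (cylIncl '' (f ⁻¹' B)) ∩ Ioc 0 (0 + 1) ×ˢ univ with hS
  have hSm : MeasurableSet S := (measurable_planeProj (hinc.measurableSet_image.2 hfB)).inter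
    (measurableSet_Ioc.prod .univ)
  have hlift : ∀ p ∈ S, ∃ c ∈ f ⁻¹' B,
      planeProj p = cylIncl c ∧ planeProj (F p) = cylIncl (f c) := by
    rintro ⟨t, y⟩ ⟨⟨c, hc, hcp⟩, -⟩
    refine ⟨c, hc, hcp.symm, ?_⟩
    have h1 : c.1 = (t : UnitAddCircle) := congrArg Prod.fst hcp
    have h2 : (c.2 : ℝ) = y := congrArg Prod.snd hcp
    have h3 : c = ((t : UnitAddCircle), c.2) := by rw [← h1]
    have h4 := hFf t c.2
    rw [← h3, h2] at h4
    exact Prod.ext h4.1 h4.2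
  have hSsub : S ⊆ univ ×ˢ Icc (-1 : ℝ) 1 := by
    intro p hp
    obtain ⟨c, -, hc, -⟩ := hlift p hp
    have h2 : p.2 = c.2 := congrArg Prod.snd hc
    exact ⟨mem_univ _, h2 ▸ c.2.2⟩
  have hinj : InjOn (planeProj ∘ F) S := by
    intro p hp q hq hpq
    obtain ⟨c, -, hc, hfc⟩ := hlift p hp
    obtain ⟨d, -, hd, hfd⟩ := hlift q hq
    refine injOn_planeProj 0 hp.2 hq.2 ?_
    rw [hc, hd, f.injective (hinc.injective (hfc.symm.trans (hpq.trans hfd)))]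
  have hder : ∀ p ∈ S, HasFDerivWithinAt F (fderivWithin ℝ F (univ ×ˢ Icc (-1) 1) p) S p :=
    fun p hp => ((hF.differentiableOn one_ne_zero p (hSsub hp)).hasFDerivWithinAt).mono hSsub
  have hinjF : InjOn F S := fun p hp q hq h => hinj hp hq (congrArg planeProj h)
  have himage : planeProj '' S = cylIncl '' (f ⁻¹' B) := by
    rw [hS, image_preimage_inter, (surjOn_planeProj 0).image_eq_of_mapsTo (mapsTo_univ _ _),
      inter_univ]
  have himageF : planeProj '' (F '' S) = cylIncl '' B := by
    ext z
    constructor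
    · rintro ⟨_, ⟨p, hp, rfl⟩, rfl⟩
      obtain ⟨c, hc, -, hfc⟩ := hlift p hp
      exact ⟨f c, hc, hfc.symm⟩
    · rintro ⟨b, hb, rfl⟩
      have hz : cylIncl (f.symm b) ∈ planeProj '' S :=
        himage ▸ mem_image_of_mem _ (by simpa using hb)
      obtain ⟨p, hp, hpz⟩ := hz
      obtain ⟨c, -, hc, hfc⟩ := hlift p hp
      refine ⟨F p, mem_image_of_mem _ hp, ?_⟩
      rw [hfc, ← hinc.injective (hpz.symm.trans hc), f.apply_symm_apply]
  rw [← himage, ← himageF,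
    volume_image_planeProj_of_injOn hSm ((injOn_planeProj 0).mono inter_subset_right),
    volume_image_planeProj_of_injOn (measurable_image_of_fderivWithin hSm hder hinjF)
      hinj.image_of_comp,
    ← lintegral_abs_det_fderiv_eq_addHaar_image volume hSm hder hinjF,
    setLIntegral_congr_fun (g := fun _ => 1) hSm fun p hp => by simp [hdet p (hSsub hp)]]
  simp

/-! ### Area preservation: the sphere -/

/-- The charts are stereographic projections, given by formulas that are smooth in the ambient space
away from the hyperplane tangent at the pole. -/
theorem contMDiffOn_sphere_of_coe {n : ℕ} {E F : Type*} [NormedAddCommGroup E]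
    [InnerProductSpace ℝ E] [Fact (Module.finrank ℝ E = n + 1)] [NormedAddCommGroup F]
    [NormedSpace ℝ F] {m : ℕ∞ω} {s : Set F} {g : F → Metric.sphere (0 : E) 1}
    (hg : ContDiffOn ℝ m (fun x => (g x : E)) s) : ContMDiffOn 𝓘(ℝ, F) (𝓡 n) m g s := by
  rw [contMDiffOn_iff_target]
  refine ⟨continuousOn_iff_continuous_domRestrict.2 (continuous_induced_rng.2
    (continuousOn_iff_continuous_domRestrict.1 hg.continuousOn)), ?_⟩
  intro v
  let U : _ ≃ₗᵢ[ℝ] _ := (OrthonormalBasis.fromOrthogonalSpanSingleton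
    n (ne_zero_of_mem_unit_sphere (-v))).repr
  have h : ContDiffOn ℝ ω _ Set.univ := U.contDiff.contDiffOn
  have H₁ := (h.comp_inter contDiffOn_stereoToFun).contMDiffOn
  convert! (H₁.of_le le_top).comp' hg.contMDiffOn using 1
  ext x
  -- On the sphere, avoiding the pole `-v` of the chart is the same as avoiding the tangent
  -- hyperplane there.
  have hfxv : (g x : E) = -↑v ↔ inner ℝ (g x : E) (-↑v) = 1 := by
    rw [inner_eq_one_iff_of_norm_eq_one (by simp)]
    exact norm_eq_of_mem_sphere (-v)
  simp [chartAt, ChartedSpace.chartAt, Subtype.ext_iff, hfxv, real_inner_comm]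

/-- The radial projection of `ℝ³` minus the origin onto the sphere. -/
noncomputable def radialProj (x : E3) : Sph :=
  if hx : x = 0 then Classical.choice (NormedSpace.sphere_nonempty.2 zero_le_one).to_subtype
  else ⟨‖x‖⁻¹ • x, by simp [norm_smul, hx]⟩

theorem coe_radialProj {x : E3} (hx : x ≠ 0) : (radialProj x : E3) = ‖x‖⁻¹ • x := by
  simp [radialProj, hx]

theorem norm_smul_radialProj {x : E3} (hx : x ≠ 0) : ‖x‖ • (radialProj x : E3) = x := by
  rw [coe_radialProj hx, smul_smul, mul_inv_cancel₀ (norm_ne_zero_iff.2 hx), one_smul]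

theorem radialProj_smul {r : ℝ} (hr : 0 < r) (n : Sph) : radialProj (r • (n : E3)) = n := by
  have hn : ‖(n : E3)‖ = 1 := by simp
  have h0 : r • (n : E3) ≠ 0 := by
    rw [← norm_ne_zero_iff, norm_smul, hn]
    simp [hr.ne']
  apply Subtype.ext
  rw [coe_radialProj h0, norm_smul, hn, mul_one, smul_smul, Real.norm_of_nonneg hr.le,
    inv_mul_cancel₀ hr.ne', one_smul]

theorem contMDiffOn_radialProj : ContMDiffOn 𝓘(ℝ, E3) (𝓡 2) 1 radialProj {0}ᶜ := by
  have h : ContDiffOn ℝ 1 (fun x => (radialProj x : E3)) {0}ᶜ := by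
    refine ContDiffOn.congr (f := fun x => ‖x‖⁻¹ • x) ?_ fun x hx => coe_radialProj hx
    intro x hx
    have hx' : x ≠ 0 := hx
    exact (((contDiffAt_norm ℝ hx').inv (norm_ne_zero_iff.2 hx')).smul
      contDiffAt_id).contDiffWithinAt
  exact contMDiffOn_sphere_of_coe h

theorem mdifferentiableAt_radialProj {x : E3} (hx : x ≠ 0) :
    MDifferentiableAt 𝓘(ℝ, E3) (𝓡 2) radialProj x :=
  (contMDiffOn_radialProj.contMDiffAt (isOpen_compl_singleton.mem_nhds hx)).mdifferentiableAt
    one_ne_zero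

theorem measurable_radialProj : Measurable radialProj :=
  measurable_of_continuousOn_compl_singleton 0 contMDiffOn_radialProj.continuousOn

/-- The extension of a self-map of the sphere to `ℝ³` that is homogeneous of degree one. -/
noncomputable def homogExt (f : Sph → Sph) (x : E3) : E3 := ‖x‖ • (f (radialProj x) : E3)

theorem homogExt_smul (f : Sph → Sph) {r : ℝ} (hr : 0 ≤ r) (n : Sph) :
    homogExt f (r • (n : E3)) = r • (f n : E3) := by
  rcases hr.eq_or_lt with rfl | hr
  · simp [homogExt]
  · have hn : ‖(n : E3)‖ = 1 := by simp
    rw [homogExt, radialProj_smul hr, norm_smul, hn, mul_one, Real.norm_of_nonneg hr.le]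

/-- The differential of the radial projection. -/
noncomputable def radialDeriv (x : E3) (u : E3) : TangentSpace (𝓡 2) (radialProj x) :=
  mfderiv 𝓘(ℝ, E3) (𝓡 2) radialProj x u

theorem exists_hasFDerivAt_homogExt {f : Sph → Sph} (hf : ContMDiff (𝓡 2) (𝓡 2) 1 f) {x : E3}
    (hx : x ≠ 0) : ∃ L : E3 →L[ℝ] E3, HasFDerivAt (homogExt f) L x ∧
      ∀ u, L u = fderiv ℝ (fun x : E3 => ‖x‖) x u • (f (radialProj x) : E3) +
        ‖x‖ • sphDincl (f (radialProj x))
          (mfderiv (𝓡 2) (𝓡 2) f (radialProj x) (radialDeriv x u)) := by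
  have h1 := mdifferentiableAt_radialProj hx
  have h2 : MDifferentiableAt (𝓡 2) (𝓡 2) f (radialProj x) :=
    (hf (radialProj x)).mdifferentiableAt one_ne_zero
  have h3 : MDifferentiableAt (𝓡 2) 𝓘(ℝ, E3) ((↑) : Sph → E3) (f (radialProj x)) :=
    (contMDiff_coe_sphere (m := 1) _).mdifferentiableAt one_ne_zero
  have h4 := (h3.hasMFDerivAt.comp x (h2.hasMFDerivAt.comp x h1.hasMFDerivAt)).hasFDerivAt
  have h5 : HasFDerivAt (fun x : E3 => ‖x‖) _ x :=
    ((contDiffAt_norm ℝ hx).differentiableAt one_ne_zero).hasFDerivAt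
  refine ⟨_, h5.smul h4, fun u => ?_⟩
  exact add_comm _ _

/-- The extension is linear along each ray from the origin, so its radial derivative can be read off
the ray. -/
theorem hasFDerivAt_homogExt_apply_radialProj {f : Sph → Sph} {x : E3} (hx : x ≠ 0)
    {L : E3 →L[ℝ] E3} (hL : HasFDerivAt (homogExt f) L x) :
    L (radialProj x) = f (radialProj x) := by
  have h1 : HasDerivAt (fun t : ℝ => t • (radialProj x : E3)) (radialProj x : E3) ‖x‖ := by
    simpa using (hasDerivAt_id ‖x‖).smul_const (radialProj x : E3)
  have h2 : HasDerivAt (fun t : ℝ => t • (f (radialProj x) : E3)) (f (radialProj x) : E3) ‖x‖ := by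
    simpa using (hasDerivAt_id ‖x‖).smul_const (f (radialProj x) : E3)
  have hL' : HasFDerivAt (homogExt f) L (‖x‖ • (radialProj x : E3)) := by
    rwa [norm_smul_radialProj hx]
  refine (hL'.comp_hasDerivAt ‖x‖ h1).unique (h2.congr_of_eventuallyEq ?_)
  filter_upwards [lt_mem_nhds (norm_pos_iff.2 hx)] with t ht
  exact homogExt_smul f ht.le _

/-- This is the derivative formula for `f = id`, whose extension is the identity; it splits `u` into
radial and tangential parts. -/
theorem eq_add_smul_sphDincl {x : E3} (hx : x ≠ 0) (u : E3) :
    u = fderiv ℝ (fun x : E3 => ‖x‖) x u • (radialProj x : E3) +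
      ‖x‖ • sphDincl (radialProj x) (radialDeriv x u) := by
  obtain ⟨L, hL, hLu⟩ := exists_hasFDerivAt_homogExt (f := id) contMDiff_id hx
  have h : HasFDerivAt (homogExt id) (ContinuousLinearMap.id ℝ E3) x := by
    refine (hasFDerivAt_id x).congr_of_eventuallyEq ?_
    filter_upwards [isOpen_compl_singleton.mem_nhds hx] with y hy
    exact norm_smul_radialProj hy
  have h2 := hLu u
  rw [hL.unique h, mfderiv_id] at h2
  exact h2

/-- The determinant of three vectors of `ℝ³`. -/
noncomputable def detRows (a b c : E3) : ℝ := Matrix.det (Matrix.of ![a.ofLp, b.ofLp, c.ofLp])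

theorem detRows_add_smul (p u v : E3) (s t r : ℝ) :
    detRows p (s • p + r • u) (t • p + r • v) = r ^ 2 * detRows p u v := by
  simp only [detRows, Matrix.det_fin_three, Matrix.of_apply, Matrix.cons_val_zero,
    Matrix.cons_val_one, Matrix.cons_val, PiLp.add_apply, PiLp.smul_apply, smul_eq_mul]
  ring

theorem detRows_map (L : E3 →ₗ[ℝ] E3) (a b c : E3) :
    detRows (L a) (L b) (L c) = LinearMap.det L * detRows a b c := by
  have key (a b c : E3) :
      detRows a b c = (EuclideanSpace.basisFun (Fin 3) ℝ).toBasis.det ![a, b, c] := by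
    rw [detRows, Module.Basis.det_apply, ← Matrix.det_transpose]
    congr 1
    ext i j
    fin_cases j <;> simp [Module.Basis.toMatrix_apply]
  have h : ![L a, L b, L c] = L ∘ ![a, b, c] := by
    ext i
    fin_cases i <;> rfl
  rw [key, key, h, Module.Basis.det_comp]

theorem exists_detRows_ne_zero {a : E3} (ha : a ≠ 0) : ∃ b c, detRows a b c ≠ 0 := by
  by_contra! h
  refine ha ?_
  have h0 := h !₂[0, 1, 0] !₂[0, 0, 1]
  have h1 := h !₂[0, 0, 1] !₂[1, 0, 0]
  have h2 := h !₂[1, 0, 0] !₂[0, 1, 0]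
  simp [detRows, Matrix.det_fin_three] at h0 h1 h2
  ext i
  fin_cases i <;> simp [h0, h1, h2]

/-- With `n = radialProj x`, `L` sends `n` to `f n` and keeps the radial coefficients of `b` and
`c`. Row operations reduce both determinants to ‖x‖² times the area form, which `f` preserves. -/
theorem exists_hasFDerivAt_homogExt_det_eq_one {f : Sph → Sph} (hf : IsC1SymplecticSph f) {x : E3}
    (hx : x ≠ 0) : ∃ L : E3 →L[ℝ] E3, HasFDerivAt (homogExt f) L x ∧ L.det = 1 := by
  obtain ⟨L, hL, hLu⟩ := exists_hasFDerivAt_homogExt hf.1 hx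
  refine ⟨L, hL, ?_⟩
  have hn := hasFDerivAt_homogExt_apply_radialProj hx hL
  have hn0 : (radialProj x : E3) ≠ 0 := by
    rw [← norm_ne_zero_iff]
    simp
  obtain ⟨b, c, hbc⟩ := exists_detRows_ne_zero hn0
  have h1 : detRows (L (radialProj x)) (L b) (L c) = detRows (radialProj x) b c := by
    conv_rhs => rw [eq_add_smul_sphDincl hx b, eq_add_smul_sphDincl hx c]
    rw [hn, hLu b, hLu c, detRows_add_smul, detRows_add_smul]
    congr 1
    exact hf.2 (radialProj x) (radialDeriv x b) (radialDeriv x c)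
  have h2 := detRows_map (L : E3 →ₗ[ℝ] E3) (radialProj x) b c
  simp only [ContinuousLinearMap.coe_coe] at h2
  rw [h1] at h2
  exact (mul_right_cancel₀ hbc (by rw [one_mul]; exact h2)).symm

/-- The truncated cone over a subset of the sphere. -/
def cone (B : Set Sph) : Set E3 := radialProj ⁻¹' B ∩ {x | x ≠ 0 ∧ ‖x‖ < 1}

theorem measurableSet_cone {B : Set Sph} (hB : MeasurableSet B) : MeasurableSet (cone B) :=
  (measurable_radialProj hB).inter ((measurableSet_singleton 0).compl.inter
    (measurableSet_lt measurable_norm measurable_const))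

open scoped Pointwise in
-- `Measure.toSphere` measures `B` by the volume of this cone, up to a constant factor, which turns
-- area on the sphere into volume in `ℝ³`.
theorem Ioo_smul_eq_cone (B : Set Sph) : Ioo (0 : ℝ) 1 • ((↑) '' B : Set E3) = cone B := by
  ext x
  constructor
  · rintro ⟨r, hr, _, ⟨n, hn, rfl⟩, rfl⟩
    have h1 : ‖(n : E3)‖ = 1 := by simp
    have h2 : ‖r • (n : E3)‖ = r := by rw [norm_smul, h1, mul_one, Real.norm_of_nonneg hr.1.le]
    refine ⟨by simpa [radialProj_smul hr.1] using hn, ?_, ?_⟩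
    · exact norm_ne_zero_iff.1 (h2.trans_ne hr.1.ne')
    · exact h2.trans_lt hr.2
  · rintro ⟨hB, h0, h1⟩
    exact ⟨‖x‖, ⟨norm_pos_iff.2 h0, h1⟩, _, mem_image_of_mem _ hB, norm_smul_radialProj h0⟩

theorem norm_homogExt (f : Sph → Sph) (x : E3) : ‖homogExt f x‖ = ‖x‖ := by
  simp [homogExt, norm_smul]

theorem radialProj_homogExt (f : Sph → Sph) {x : E3} (hx : x ≠ 0) :
    radialProj (homogExt f x) = f (radialProj x) :=
  radialProj_smul (norm_pos_iff.2 hx) _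

theorem homogExt_homogExt {f g : Sph → Sph} (h : ∀ n, f (g n) = n) {x : E3} (hx : x ≠ 0) :
    homogExt f (homogExt g x) = x := by
  rw [homogExt, radialProj_homogExt g hx, norm_homogExt, h, norm_smul_radialProj hx]

theorem homogExt_mem_cone {f : Sph → Sph} {B : Set Sph} {x : E3} (hx : x ∈ cone (f ⁻¹' B)) :
    homogExt f x ∈ cone B := by
  refine ⟨?_, ?_, ?_⟩
  · rw [mem_preimage, radialProj_homogExt f hx.2.1]
    exact hx.1
  · rw [← norm_ne_zero_iff, norm_homogExt]
    exact norm_ne_zero_iff.2 hx.2.1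
  · exact (norm_homogExt f x).trans_lt hx.2.2

/-- The homogeneous extension maps the cone over `f ⁻¹' B` bijectively onto the cone over `B` with
Jacobian 1. -/
theorem measurePreserving_of_isC1SymplecticSph {f : Sph ≃ₜ Sph} (hf : IsC1SymplecticSph f) :
    MeasurePreserving f (volume : Measure E3).toSphere (volume : Measure E3).toSphere := by
  refine ⟨f.continuous.measurable, ?_⟩
  ext B hB
  have hfB : MeasurableSet (f ⁻¹' B) := f.continuous.measurable hB
  rw [Measure.map_apply f.continuous.measurable hB, Measure.toSphere_apply' _ hB,
    Measure.toSphere_apply' _ hfB, Ioo_smul_eq_cone, Ioo_smul_eq_cone]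
  congr 1
  have himage : homogExt f '' cone (f ⁻¹' B) = cone B := by
    refine Subset.antisymm (image_subset_iff.2 fun x hx => homogExt_mem_cone hx) fun x hx => ?_
    refine ⟨homogExt f.symm x, homogExt_mem_cone ?_, homogExt_homogExt f.apply_symm_apply hx.2.1⟩
    simpa [← preimage_comp] using hx
  have hinj : InjOn (homogExt f) (cone (f ⁻¹' B)) := fun x hx y hy hxy => by
    rw [← homogExt_homogExt f.symm_apply_apply hx.2.1, hxy,
      homogExt_homogExt f.symm_apply_apply hy.2.1]
  have hder : ∀ x, ∃ L : E3 →L[ℝ] E3, x ≠ 0 → HasFDerivAt (homogExt f) L x ∧ L.det = 1 := by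
    intro x
    by_cases hx : x = 0
    · exact ⟨0, fun h => absurd hx h⟩
    · obtain ⟨L, hL⟩ := exists_hasFDerivAt_homogExt_det_eq_one hf hx
      exact ⟨L, fun _ => hL⟩
  choose L hL using hder
  rw [← himage, ← lintegral_abs_det_fderiv_eq_addHaar_image volume (measurableSet_cone hfB)
    (fun x hx => (hL x hx.2.1).1.hasFDerivWithinAt) hinj,
    setLIntegral_congr_fun (g := fun _ => 1) (measurableSet_cone hfB) fun x hx => by
      simp [(hL x hx.2.1).2]]
  simp

/-! ### The three surfaces -/

namespace Surface

instance : (M : Surface) → CompactSpace M.Carrier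
  | cylinder => inferInstanceAs (CompactSpace Cyl)
  | disk => inferInstanceAs (CompactSpace Dsk)
  | sphere => inferInstanceAs (CompactSpace Sph)

instance : (M : Surface) → TopologicalSpace.MetrizableSpace M.Carrier
  | cylinder => inferInstanceAs (TopologicalSpace.MetrizableSpace Cyl)
  | disk => inferInstanceAs (TopologicalSpace.MetrizableSpace Dsk)
  | sphere => inferInstanceAs (TopologicalSpace.MetrizableSpace Sph)

instance : (M : Surface) → BorelSpace M.Carrier
  | cylinder => inferInstanceAs (BorelSpace Cyl)
  | disk => inferInstanceAs (BorelSpace Dsk)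
  | sphere => inferInstanceAs (BorelSpace Sph)

/-- The function on a surface that corresponds to the second coordinate of the cylinder. -/
def height : (M : Surface) → M.Carrier → ℝ
  | cylinder => fun p : Cyl => p.2
  | disk => fun x : Dsk => 2 * (x.1 0 ^ 2 + x.1 1 ^ 2) - 1
  | sphere => fun x : Sph => x.1 2

theorem continuous_height : (M : Surface) → Continuous M.height
  | cylinder => (by fun_prop : Continuous fun p : Cyl => (p.2 : ℝ))
  | disk => (by fun_prop : Continuous fun x : Dsk => 2 * (x.1 0 ^ 2 + x.1 1 ^ 2) - 1)
  | sphere => (by fun_prop : Continuous fun x : Sph => x.1 2)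

theorem sphere_eq_of_height_sq {x : Sph} {y : ℝ} (h : x.1 2 = y) (hy : y ^ 2 = 1) :
    x.1 = !₂[0, 0, y] := by
  have h1 := (mem_sphere_iff x.1).1 x.2
  rw [h, hy] at h1
  have h2 : x.1 0 = 0 := by nlinarith [sq_nonneg (x.1 0), sq_nonneg (x.1 1)]
  have h3 : x.1 1 = 0 := by nlinarith [sq_nonneg (x.1 0), sq_nonneg (x.1 1)]
  ext i
  fin_cases i <;> simp [h, h2, h3]

/-- Boundary circles, center and poles all become levels ±1 of one continuous function, so the later
arguments need no case distinction. -/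
theorem mem_punctured_iff :
    (M : Surface) → (x : M.Carrier) → (x ∈ M.punctured ↔ M.height x ≠ 1 ∧ M.height x ≠ -1)
  | cylinder => fun p : Cyl => by
    change (-1 < (p.2 : ℝ) ∧ (p.2 : ℝ) < 1) ↔ (p.2 : ℝ) ≠ 1 ∧ (p.2 : ℝ) ≠ -1
    refine ⟨fun h => ⟨h.2.ne, h.1.ne'⟩, fun h => ⟨p.2.2.1.lt_of_ne h.2.symm, p.2.2.2.lt_of_ne h.1⟩⟩
  | disk => fun x : Dsk => by
    have h := (mem_disk_iff x.1).1 x.2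
    have h0 : 0 ≤ x.1 0 ^ 2 + x.1 1 ^ 2 := by positivity
    change (0 < x.1 0 ^ 2 + x.1 1 ^ 2 ∧ x.1 0 ^ 2 + x.1 1 ^ 2 < 1) ↔
      2 * (x.1 0 ^ 2 + x.1 1 ^ 2) - 1 ≠ 1 ∧ 2 * (x.1 0 ^ 2 + x.1 1 ^ 2) - 1 ≠ -1
    refine ⟨fun h => ⟨by linarith, by linarith⟩,
      fun h' => ⟨h0.lt_of_ne fun h1 => h'.2 (by linarith),
        h.lt_of_ne fun h1 => h'.1 (by linarith)⟩⟩
  | sphere => fun x : Sph => by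
    change (x.1 ≠ !₂[0, 0, 1] ∧ x.1 ≠ !₂[0, 0, -1]) ↔ x.1 2 ≠ 1 ∧ x.1 2 ≠ -1
    refine and_congr (not_congr ⟨fun h => by simp [h], fun h => ?_⟩)
      (not_congr ⟨fun h => by simp [h], fun h => ?_⟩)
    · exact sphere_eq_of_height_sq h (by norm_num)
    · exact sphere_eq_of_height_sq h (by norm_num)

theorem punctured_eq_compl (M : Surface) :
    M.punctured = ({x | M.height x = 1} ∪ {x | M.height x = -1})ᶜ := by
  ext x
  simp [mem_punctured_iff]

theorem measurableSet_height_eq (M : Surface) (y : ℝ) : MeasurableSet {x | M.height x = y} :=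
  M.continuous_height.measurable (measurableSet_singleton y)

theorem height_proj : (M : Surface) → (p : Cyl) → M.height (M.proj p) = p.2
  | cylinder => fun _ => rfl
  | disk => fun p => by
    have h1 := cosT_sq_add_sinT_sq p.1
    have h2 := Real.sq_sqrt (show 0 ≤ (1 + (p.2 : ℝ)) / 2 by linarith [p.2.2.1])
    change 2 * ((√((1 + p.2.1) / 2) * cosT p.1) ^ 2 + (√((1 + p.2.1) / 2) * sinT p.1) ^ 2) - 1 = _
    rw [mul_pow, mul_pow, ← mul_add, h1, h2]
    ring
  | sphere => fun _ => rfl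

theorem continuous_cosT : Continuous cosT :=
  Complex.continuous_re.comp (continuous_subtype_val.comp AddCircle.continuous_toCircle)

theorem continuous_sinT : Continuous sinT :=
  Complex.continuous_im.comp (continuous_subtype_val.comp AddCircle.continuous_toCircle)

theorem continuous_proj : (M : Surface) → Continuous M.proj
  | cylinder => continuous_id
  | disk => by
    have h1 := continuous_cosT
    have h2 := continuous_sinT
    refine Continuous.subtype_mk ?_ _
    refine (PiLp.continuous_toLp 2 _).comp (continuous_pi fun i => ?_)
    fin_cases i <;> simp <;> fun_prop
  | sphere => by
    have h1 := continuous_cosT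
    have h2 := continuous_sinT
    refine Continuous.subtype_mk ?_ _
    refine (PiLp.continuous_toLp 2 _).comp (continuous_pi fun i => ?_)
    fin_cases i <;> simp <;> fun_prop

theorem continuous_circle (M : Surface) (y : I) : Continuous fun θ => M.proj (θ, y) :=
  M.continuous_proj.comp (Continuous.prodMk_left y)

theorem height_rot :
    (M : Surface) → (α : UnitAddCircle) → (x : M.Carrier) → M.height (M.rot α x) = M.height x
  | cylinder => fun _ _ => rfl
  | disk => fun α (x : Dsk) => by
    have h1 := cosT_sq_add_sinT_sq α
    change 2 * ((cosT α * x.1 0 - sinT α * x.1 1) ^ 2 + (sinT α * x.1 0 + cosT α * x.1 1) ^ 2) - 1 =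
      2 * (x.1 0 ^ 2 + x.1 1 ^ 2) - 1
    linear_combination 2 * (x.1 0 ^ 2 + x.1 1 ^ 2) * h1
  | sphere => fun _ _ => rfl

theorem cosT_add (α β : UnitAddCircle) : cosT (α + β) = cosT α * cosT β - sinT α * sinT β := by
  simp [cosT, sinT, AddCircle.toCircle_add]

theorem sinT_add (α β : UnitAddCircle) : sinT (α + β) = sinT α * cosT β + cosT α * sinT β := by
  simp [cosT, sinT, AddCircle.toCircle_add]
  ring

theorem rot_proj :
    (M : Surface) → (α θ : UnitAddCircle) → (y : I) → M.rot α (M.proj (θ, y)) = M.proj (θ + α, y)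
  | cylinder => fun _ _ _ => rfl
  | disk => fun α θ y => by
    change rotDskFun α (piDsk (θ, y)) = piDsk (θ + α, y)
    apply Subtype.ext
    ext i
    fin_cases i <;> simp [rotDskFun, piDsk, cosT_add, sinT_add] <;> ring
  | sphere => fun α θ y => by
    change rotSphFun α (piSph (θ, y)) = piSph (θ + α, y)
    apply Subtype.ext
    ext i
    fin_cases i <;> simp [rotSphFun, piSph, cosT_add, sinT_add] <;> ring

/-! ### The measures -/

theorem comap_volume_closedBall_univ :
    (volume : Measure E2).comap ((↑) : Dsk → E2) univ = volume (Metric.closedBall (0 : E2) 1) := by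
  rw [comap_subtype_coe_apply Metric.isClosed_closedBall.measurableSet, image_univ,
    Subtype.range_coe]

theorem area_univ_ne_zero : (M : Surface) → M.area univ ≠ 0
  | cylinder => cylArea_univ.trans_ne two_ne_zero
  | disk => comap_volume_closedBall_univ.trans_ne (Metric.measure_closedBall_pos _ _ one_pos).ne'
  | sphere => Measure.measure_univ_ne_zero.2 (Measure.toSphere_ne_zero _)

theorem area_univ_ne_top : (M : Surface) → M.area univ ≠ ⊤
  | cylinder => cylArea_univ.trans_ne (by simp)
  | disk => comap_volume_closedBall_univ.trans_ne measure_closedBall_lt_top.ne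
  | sphere => measure_ne_top (volume : Measure E3).toSphere univ

instance (M : Surface) : IsProbabilityMeasure M.leb :=
  ⟨by rw [leb, Measure.smul_apply, smul_eq_mul,
    ENNReal.inv_mul_cancel M.area_univ_ne_zero M.area_univ_ne_top]⟩

instance (M : Surface) (y : I) : IsProbabilityMeasure (M.circleMeasure y) :=
  have : IsProbabilityMeasure (volume : Measure UnitAddCircle) := ⟨UnitAddCircle.measure_univ⟩
  Measure.isProbabilityMeasure_map (M.continuous_circle y).aemeasurable

/-- The cone over a point lies in a line of `ℝ³`. -/
theorem toSphere_singleton (n : Sph) : (volume : Measure E3).toSphere {n} = 0 := by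
  rw [Measure.toSphere_apply' _ (measurableSet_singleton n)]
  refine mul_eq_zero_of_right _ (measure_mono_null (t := (ℝ ∙ (n : E3) : Submodule ℝ E3)) ?_
    (Measure.addHaar_submodule _ _ fun h => ?_))
  · rintro _ ⟨r, -, _, ⟨m, hm, rfl⟩, rfl⟩
    rw [mem_singleton_iff.1 hm]
    exact Submodule.smul_mem _ _ (Submodule.mem_span_singleton_self _)
  · have h1 := finrank_span_singleton (K := ℝ) (v := (n : E3)) (by
      rw [← norm_ne_zero_iff]; simp)
    rw [h] at h1
    simp at h1

theorem area_height_eq :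
    (M : Surface) → (y : ℝ) → y = 1 ∨ y = -1 → M.area {x | M.height x = y} = 0
  | cylinder => fun y _ => by
    change cylArea {p : Cyl | (p.2 : ℝ) = y} = 0
    rw [cylArea_apply]
    refine measure_mono_null (t := univ ×ˢ {y}) ?_ (by simp [Measure.volume_eq_prod])
    rintro _ ⟨p, hp, rfl⟩
    exact ⟨mem_univ _, hp⟩
  | disk => fun y hy => by
    change (volume : Measure E2).comap ((↑) : Dsk → E2)
      {x : Dsk | 2 * (x.1 0 ^ 2 + x.1 1 ^ 2) - 1 = y} = 0
    rw [comap_subtype_coe_apply Metric.isClosed_closedBall.measurableSet]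
    refine measure_mono_null (t := Metric.sphere (0 : E2) 1 ∪ {0}) ?_
      (measure_union_null (Measure.addHaar_sphere _ _ _) (measure_singleton _))
    rintro _ ⟨x, hx, rfl⟩
    have hx' : 2 * (x.1 0 ^ 2 + x.1 1 ^ 2) - 1 = y := hx
    rcases hy with rfl | rfl
    · left
      rw [mem_sphere_zero_iff_norm, EuclideanSpace.norm_eq, Real.sqrt_eq_one]
      simp only [Fin.sum_univ_two, Real.norm_eq_abs, sq_abs]
      linarith
    · right
      have h2 : x.1 0 = 0 := by nlinarith [sq_nonneg (x.1 0), sq_nonneg (x.1 1)]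
      have h3 : x.1 1 = 0 := by nlinarith [sq_nonneg (x.1 0), sq_nonneg (x.1 1)]
      rw [mem_singleton_iff]
      ext i
      fin_cases i <;> simp [h2, h3]
  | sphere => fun y hy => by
    change (volume : Measure E3).toSphere {x : Sph | x.1 2 = y} = 0
    have hsub : {x : Sph | x.1 2 = y}.Subsingleton := fun p hp q hq => by
      have hy2 : y ^ 2 = 1 := by rcases hy with rfl | rfl <;> norm_num
      exact Subtype.ext ((sphere_eq_of_height_sq hp hy2).trans (sphere_eq_of_height_sq hq hy2).symm)
    rcases hsub.eq_empty_or_singleton with h | ⟨n, h⟩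
    · rw [h, measure_empty]
    · rw [h, toSphere_singleton]

theorem measurePreserving_area_of_mem_symp1 :
    (M : Surface) → {f : M.Carrier ≃ₜ M.Carrier} → f ∈ M.symp1 → MeasurePreserving f M.area M.area
  | cylinder => fun hf => measurePreserving_of_isC1SymplecticCyl hf.1
  | disk => fun hf => measurePreserving_of_isC1SymplecticDsk hf.1
  | sphere => fun hf => measurePreserving_of_isC1SymplecticSph hf.1

/-! ### Invariant measures and strata for maps in the limit class -/

variable {M : Surface} {f : M.Carrier ≃ₜ M.Carrier}

theorem measurePreserving_leb (hf : f ∈ M.symp0) : MeasurePreserving f M.leb M.leb :=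
  mem_of_mem_c0Closure (isClosed_measurePreserving M.leb)
    (fun _ hg => (M.measurePreserving_area_of_mem_symp1 hg).smul_measure _) hf

/-- The conjugating map fixes the levels ±1 pointwise and the rotation preserves them, so
conjugation is invisible there. The angle depends on `f`; only consequences free of it are passed to
the limit. -/
theorem eq_rot_of_mem_rationalConjugates (hf : f ∈ M.rationalConjugates) :
    ∃ α, ∀ x, M.height x = 1 ∨ M.height x = -1 → f x = M.rot α x := by
  obtain ⟨h, hh, r, hfr⟩ := hf
  have hnot {x : M.Carrier} (hx : M.height x = 1 ∨ M.height x = -1) : x ∉ M.punctured := by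
    rw [mem_punctured_iff]
    tauto
  refine ⟨((r : ℝ) : UnitAddCircle), fun x hx => ?_⟩
  have h1 : h.symm x = x := by
    rw [h.symm_apply_eq, hh.2 x (hnot hx)]
  rw [hfr, h1, hh.2 _ (hnot (by rwa [height_rot]))]

theorem height_apply_of_mem_limitClass (hf : f ∈ M.limitClass) {x : M.Carrier}
    (hx : M.height x = 1 ∨ M.height x = -1) : M.height (f x) = M.height x := by
  have hclosed : IsClosed {g : C(M.Carrier, M.Carrier) | M.height (g x) = M.height x} :=
    isClosed_eq (M.continuous_height.comp (continuous_eval_const x)) continuous_const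
  refine mem_of_mem_c0Closure hclosed (fun g hg => ?_) hf.2
  obtain ⟨α, hα⟩ := eq_rot_of_mem_rationalConjugates hg
  change M.height (g x) = M.height x
  rw [hα x hx, height_rot]

theorem measurePreserving_circleMeasure (hf : f ∈ M.limitClass) {y : I}
    (hy : (y : ℝ) = 1 ∨ (y : ℝ) = -1) :
    MeasurePreserving f (M.circleMeasure y) (M.circleMeasure y) := by
  refine mem_of_mem_c0Closure (isClosed_measurePreserving (M.circleMeasure y)) (fun g hg => ?_) hf.2
  obtain ⟨α, hα⟩ := eq_rot_of_mem_rationalConjugates hg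
  refine ⟨g.continuous.measurable, ?_⟩
  have hc := (M.continuous_circle y).measurable
  have h : (g ∘ fun θ => M.proj (θ, y)) = (fun θ => M.proj (θ, y)) ∘ fun θ => θ + α := by
    funext θ
    exact (hα _ (by rwa [height_proj])).trans (M.rot_proj α θ y)
  change Measure.map g (M.circleMeasure y) = M.circleMeasure y
  rw [circleMeasure, Measure.map_map g.continuous.measurable hc, h,
    ← Measure.map_map hc (measurable_add_const α), map_add_right_eq_self]

theorem circleMeasure_height_eq (M : Surface) (y : I) :
    M.circleMeasure y {x | M.height x = y} = 1 := by
  rw [circleMeasure, Measure.map_apply (M.continuous_circle y).measurable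
    (M.measurableSet_height_eq y)]
  simp [height_proj]

theorem leb_punctured (M : Surface) : M.leb M.punctured = 1 := by
  rw [punctured_eq_compl, prob_compl_eq_one_iff
    ((M.measurableSet_height_eq _).union (M.measurableSet_height_eq _)), leb, Measure.smul_apply,
    measure_union_null (M.area_height_eq _ (.inl rfl)) (M.area_height_eq _ (.inr rfl)), smul_zero]

/-- The decomposition of a surface in its interior part and its two extreme circles. -/
def strata (M : Surface) : Fin 3 → Set M.Carrier :=
  ![M.punctured, {x | M.height x = 1}, {x | M.height x = -1}]

theorem iUnion_strata (M : Surface) : ⋃ i, M.strata i = univ := by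
  refine eq_univ_of_forall fun x => mem_iUnion.2 ?_
  by_cases h1 : M.height x = 1
  · exact ⟨1, h1⟩
  by_cases h2 : M.height x = -1
  · exact ⟨2, h2⟩
  · exact ⟨0, (M.mem_punctured_iff x).2 ⟨h1, h2⟩⟩

theorem disjoint_strata (M : Surface) : Pairwise fun i j => Disjoint (M.strata i) (M.strata j) := by
  have h01 : Disjoint (M.strata 0) (M.strata 1) :=
    disjoint_left.2 fun x hx => ((M.mem_punctured_iff x).1 hx).1
  have h02 : Disjoint (M.strata 0) (M.strata 2) :=
    disjoint_left.2 fun x hx => ((M.mem_punctured_iff x).1 hx).2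
  have h12 : Disjoint (M.strata 1) (M.strata 2) :=
    disjoint_left.2 fun x (h1 : M.height x = 1) (h2 : M.height x = -1) => by linarith
  intro i j hij
  fin_cases i <;> fin_cases j <;> first | exact absurd rfl hij | assumption | (symm; assumption)

theorem measurableSet_strata (M : Surface) (i : Fin 3) : MeasurableSet (M.strata i) := by
  have hm := M.measurableSet_height_eq
  fin_cases i
  · change MeasurableSet M.punctured
    rw [punctured_eq_compl]
    exact ((hm _).union (hm _)).compl
  · exact hm _
  · exact hm _

theorem measure_strata_eq_zero_or_one (hf : f ∈ M.limitClass) {μ : Measure M.Carrier}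
    [IsProbabilityMeasure μ] (hμ : Ergodic f μ) (i : Fin 3) :
    μ (M.strata i) = 0 ∨ μ (M.strata i) = 1 := by
  have hm := M.measurableSet_height_eq
  -- Forward invariance is enough for ergodicity to apply; the punctured stratum is then treated as
  -- the complement of a forward invariant set.
  have key {s : Set M.Carrier} (hs : MeasurableSet s) (hfs : s ⊆ f ⁻¹' s) : μ s = 0 ∨ μ s = 1 := by
    rcases hμ.ae_empty_or_univ_of_ae_le_preimage hs.nullMeasurableSet hfs.eventuallyLE with h | h
    · exact .inl (by rw [measure_congr h, measure_empty])
    · exact .inr (by rw [measure_congr h, measure_univ])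
  have h1 : {x | M.height x = 1} ⊆ f ⁻¹' {x | M.height x = 1} := fun x hx =>
    (height_apply_of_mem_limitClass hf (.inl hx)).trans hx
  have h2 : {x | M.height x = -1} ⊆ f ⁻¹' {x | M.height x = -1} := fun x hx =>
    (height_apply_of_mem_limitClass hf (.inr hx)).trans hx
  fin_cases i
  · change μ M.punctured = 0 ∨ μ M.punctured = 1
    have hu := (hm 1).union (hm (-1))
    rw [punctured_eq_compl, prob_compl_eq_zero_iff hu, prob_compl_eq_one_iff hu]
    exact (key hu (union_subset_union h1 h2)).symm
  · exact key (hm _) h1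
  · exact key (hm _) h2

end Surface
end MinErg

theorem mainTheorem10 (M : MinErg.Surface) (f : M.Carrier ≃ₜ M.Carrier)
    (hf : f ∈ M.limitClass) :
    MinErg.IsMinimallyErgodic f ↔
      convexHull ℝ≥0
          {M.leb, M.circleMeasure MinErg.I.top, M.circleMeasure MinErg.I.bot} =
        MinErg.invariantMeasures f := by
  -- The order matches `strata`: each measure has the index of the stratum carrying it.
  have hrange : range ![M.leb, M.circleMeasure MinErg.I.top, M.circleMeasure MinErg.I.bot] =
      {M.leb, M.circleMeasure MinErg.I.top, M.circleMeasure MinErg.I.bot} := by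
    simp only [Matrix.range_cons, Matrix.range_empty, union_empty, singleton_union]
  rw [← hrange, ← MinErg.encard_ergodicMeasures_eq_iff f.continuous M.measurableSet_strata
    M.disjoint_strata M.iUnion_strata]
  · rw [MinErg.IsMinimallyErgodic, Fintype.card_fin]
    rfl
  · intro i
    fin_cases i
    · exact ⟨inferInstanceAs (IsProbabilityMeasure M.leb),
        MinErg.Surface.measurePreserving_leb hf.1⟩
    · exact ⟨inferInstanceAs (IsProbabilityMeasure (M.circleMeasure MinErg.I.top)),
        MinErg.Surface.measurePreserving_circleMeasure hf (.inl rfl)⟩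
    · exact ⟨inferInstanceAs (IsProbabilityMeasure (M.circleMeasure MinErg.I.bot)),
        MinErg.Surface.measurePreserving_circleMeasure hf (.inr rfl)⟩
  · intro i
    fin_cases i
    · exact M.leb_punctured
    · exact M.circleMeasure_height_eq MinErg.I.top
    · exact M.circleMeasure_height_eq MinErg.I.bot
  · intro μ hμ i
    have := hμ.1
    exact MinErg.Surface.measure_strata_eq_zero_or_one hf hμ.2 i
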